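/- Let $(\Omega,\mathcal F,\mathbb P)$ be a probability space, let $a>0$, let $b=\{b(j)\}_{j\ge 1}$ be a sequence of non-negative reals that is not identically zero, and let $\xi=\{\xi(k)\}_{k\in\mathbb Z}$ be i.i.d. non-negative square-integrable random variables with mean $\lambda_1=\mathbb E[\xi(0)]>0$ and variance $\sigma^2=\mathrm{Var}[\xi(0)]>0$. Let $X=\{X(k)\}_{k\in\mathbb Z}$ be a weakly stationary solution of the ARCH($\infty$) equations $$X(k)=\varsigma(k)\,\xi(k),\qquad \varsigma(k)=a+\sum_{j=1}^{\infty}b(j)X(k-j),\qquad k\in\mathbb Z,$$ that is, almost surely the series converges and the equations hold, each $X(k)$ has finite variance, $\mathbb E[X(k)]$ does not depend on $k$, and $\mathrm{Cov}[X(n),X(n+k)]=:\rho(k)$ depends only on $k$ for all $n,k\in\mathbb Z$. For $r>0$ let $\mathcal W(r)$ be the set of sequences $\gamma=\{\gamma(n)\}_{n\ge0}$ of positive reals such that $$\lim_{n\to\infty}\frac{\gamma(n-1)}{\gamma(n)}=\frac1r,\qquad \sum_{i=0}^\infty\gamma(i)r^{-i}<\infty,\qquad \lim_{m\to\infty}\Bigl(\limsup_{n\to\infty}\frac1{\gamma(n)}\sum_{i=m}^{n-m}\gamma(n-i)\gamma(i)\Bigr)=0,$$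 and let $\mathcal W^{\downarrow}(r)$ be the set of $\gamma\in\mathcal W(r)$ for which there is a non-increasing sequence $g$ of positive reals with $\gamma(n)/g(n)\to1$ as $n\to\infty$. Let $r\in(0,1]$ and suppose that $\lambda_1\sum_{j=1}^\infty b(j)r^{-j}<1$. Let $z=\{z(j)\}_{j\ge0}$ be the sequence determined by $$\frac1{1-\lambda_1\sum_{j=1}^\infty b(j)x^j}=\sum_{j=0}^\infty z(j)x^j\qquad(|x|\le1),$$ and suppose that $$\frac{\sigma}{\lambda_1}\Bigl(\sum_{j=1}^\infty z(j)^2\Bigr)^{1/2}<1 .$$ Let $\gamma\in\mathcal W^{\downarrow}(r)$ be such that $b(n)\le\gamma(n)$ for all $n\ge1$. Then there exists $C_2\in(0,\infty)$ such that $\rho(n)\le C_2\,\gamma(n)$ for all $n\ge0$. -/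

import Mathlib

open MeasureTheory ProbabilityTheory Filter Topology
open scoped ENNReal

namespace ARCH

/-! ### The equations and their weakly stationary solutions -/

/-- `X` solves the ARCH(∞) equations
`X(k) = ς(k) ξ(k)`, `ς(k) = a + ∑_{j ≥ 1} b(j) X(k - j)` for `k ∈ ℤ`,
with i.i.d. non-negative shocks `ξ`, `a ≥ 0` and `b(j) ≥ 0` for `j ≥ 1`.
The sequence `b` is indexed by `j ≥ 1`; the value `b 0` is never used. The equations hold almost
surely, and the convergence of the series is part of what they say. -/
structure IsSolution {Ω : Type*} [MeasurableSpace Ω] (P : Measure Ω)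
    (a : ℝ) (b : ℕ → ℝ) (ξ X : ℤ → Ω → ℝ) : Prop where
  a_nonneg : 0 ≤ a
  b_nonneg : ∀ j, 1 ≤ j → 0 ≤ b j
  measurable_shock : ∀ k, Measurable (ξ k)
  shock_nonneg : ∀ k, ∀ᵐ ω ∂P, 0 ≤ ξ k ω
  indep : iIndepFun ξ P
  identDistrib : ∀ k, IdentDistrib (ξ k) (ξ 0) P P
  measurable : ∀ k, Measurable (X k)
  summable : ∀ k, ∀ᵐ ω ∂P, Summable fun j : ℕ => b (j + 1) * X (k - (j + 1)) ω
  eq : ∀ k, ∀ᵐ ω ∂P, X k ω = (a + ∑' j : ℕ, b (j + 1) * X (k - (j + 1)) ω) * ξ k ω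

/-- The autocovariance function `ρ(k) = Cov[X(0), X(k)]`, `k ∈ ℤ`. -/
noncomputable def autocov {Ω : Type*} [MeasurableSpace Ω] (P : Measure Ω)
    (X : ℤ → Ω → ℝ) (k : ℤ) : ℝ :=
  cov[X 0, X k; P]

/-- Weak stationarity: finite variances, constant mean, and `Cov[X(n), X(n + k)] = ρ(k)` for all
`n` and `k`. -/
structure IsWeaklyStationary {Ω : Type*} [MeasurableSpace Ω] (P : Measure Ω)
    (X : ℤ → Ω → ℝ) : Prop where
  memLp : ∀ k, MemLp (X k) 2 P
  mean_eq : ∀ k, P[X k] = P[X 0]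
  cov_eq : ∀ n k, cov[X n, X (n + k); P] = autocov P X k

/-! ### The resolvent sequence and the stationarity constant -/

/-- The power series `ψ(x) = 1 - l ∑_{j ≥ 1} b(j) x ^ j`. -/
noncomputable def symbol (l : ℝ) (b : ℕ → ℝ) : PowerSeries ℝ :=
  1 - PowerSeries.mk fun j => if j = 0 then 0 else l * b j

/-- The sequence `z` of coefficients of `1 / ψ`. -/
noncomputable def resolvent (l : ℝ) (b : ℕ → ℝ) (n : ℕ) : ℝ :=
  PowerSeries.coeff n (symbol l b)⁻¹

/-- `(σ / λ₁) (∑_{j ≥ 1} z(j) ^ 2) ^ (1 / 2)`, where `λ₁` and `σ ^ 2` are the mean and the variance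
of the shocks. -/
noncomputable def stationarityConst {Ω : Type*} [MeasurableSpace Ω] (P : Measure Ω)
    (b : ℕ → ℝ) (ξ : ℤ → Ω → ℝ) : ℝ :=
  √(Var[ξ 0; P]) / P[ξ 0] * √(∑' j : ℕ, resolvent (P[ξ 0]) b (j + 1) ^ 2)

/-! ### The weight classes -/

/-- The class `𝒲(r)`. The upper limit is taken in `[0, ∞]`, so that it is the true one. -/
structure MemW (r : ℝ) (γ : ℕ → ℝ) : Prop where
  pos : ∀ n, 0 < γ n
  tendsto_ratio : Tendsto (fun n => γ n / γ (n + 1)) atTop (𝓝 (1 / r))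
  summable : Summable fun i => γ i * (r ^ i)⁻¹
  tendsto_limsup : Tendsto
    (fun m : ℕ => limsup (fun n : ℕ =>
      ENNReal.ofReal (1 / γ n * ∑ i ∈ Finset.Icc m (n - m), γ (n - i) * γ i)) atTop)
    atTop (𝓝 (0 : ℝ≥0∞))

/-- The subclass of those `g ∈ 𝒲(r)` that are asymptotic to a positive non-increasing sequence. -/
structure MemWDown (r : ℝ) (g : ℕ → ℝ) : Prop extends MemW r g where
  asymp : ∃ γ : ℕ → ℝ, (∀ n, 0 < γ n) ∧ (∀ n, γ (n + 1) ≤ γ n) ∧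
    Tendsto (fun n => g n / γ n) atTop (𝓝 1)

/-! ### The resolvent sequence really is given by `1 / ψ` on the closed unit disc -/

theorem constantCoeff_symbol (l : ℝ) (b : ℕ → ℝ) :
    PowerSeries.constantCoeff (symbol l b) = 1 := by
  rw [← PowerSeries.coeff_zero_eq_constantCoeff_apply]
  simp [symbol]

theorem symbol_mul_inv (l : ℝ) (b : ℕ → ℝ) : symbol l b * (symbol l b)⁻¹ = 1 :=
  PowerSeries.mul_inv_cancel _ (by rw [constantCoeff_symbol]; exact one_ne_zero)

theorem resolvent_zero (l : ℝ) (b : ℕ → ℝ) : resolvent l b 0 = 1 := by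
  simp [resolvent, constantCoeff_symbol]

theorem resolvent_succ (l : ℝ) (b : ℕ → ℝ) (n : ℕ) :
    resolvent l b (n + 1) =
      l * ∑ j ∈ Finset.range (n + 1), b (n + 1 - j) * resolvent l b j := by
  have h := congrArg (PowerSeries.coeff (n + 1)) (symbol_mul_inv l b)
  rw [symbol, sub_mul, one_mul, map_sub, mul_comm (PowerSeries.mk _), PowerSeries.coeff_mul,
    Finset.Nat.sum_antidiagonal_eq_sum_range_succ_mk, Finset.sum_range_succ,
    PowerSeries.coeff_one, if_neg (Nat.succ_ne_zero n)] at h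
  simp only [PowerSeries.coeff_mk, Nat.sub_self, if_true, mul_zero, add_zero] at h
  change resolvent l b (n + 1) - _ = 0 at h
  rw [sub_eq_zero.1 h, Finset.mul_sum]
  refine Finset.sum_congr rfl fun j hj => ?_
  have : n + 1 - j ≠ 0 := by have := Finset.mem_range.1 hj; omega
  rw [if_neg this]
  simp only [resolvent, symbol]
  ring

theorem resolvent_nonneg {l : ℝ} {b : ℕ → ℝ} (hl : 0 ≤ l) (hb : ∀ j, 1 ≤ j → 0 ≤ b j) (n : ℕ) :
    0 ≤ resolvent l b n := by
  induction n using Nat.strong_induction_on with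
  | _ n ih =>
    cases n with
    | zero => rw [resolvent_zero]; exact zero_le_one
    | succ n =>
      rw [resolvent_succ]
      refine mul_nonneg hl (Finset.sum_nonneg fun j hj => ?_)
      have := Finset.mem_range.1 hj
      exact mul_nonneg (hb _ (by omega)) (ih j this)

theorem sum_resolvent_le {l : ℝ} {b : ℕ → ℝ} (hl : 0 ≤ l) (hb : ∀ j, 1 ≤ j → 0 ≤ b j)
    (hs : Summable fun j : ℕ => b (j + 1)) (N : ℕ) :
    ∑ n ∈ Finset.range (N + 1), resolvent l b n ≤
      1 + l * (∑' j : ℕ, b (j + 1)) * ∑ n ∈ Finset.range N, resolvent l b n := by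
  rw [Finset.sum_range_succ', resolvent_zero, add_comm]
  simp only [resolvent_succ]
  rw [← Finset.mul_sum, mul_assoc]
  gcongr
  have h3 : ∑ n ∈ Finset.range N, ∑ j ∈ Finset.range (n + 1), b (n + 1 - j) * resolvent l b j =
      ∑ j ∈ Finset.range N, ∑ n ∈ Finset.Ico j N, b (n + 1 - j) * resolvent l b j := by
    refine Finset.sum_comm' fun x y => ?_
    simp only [Finset.mem_range, Finset.mem_Ico]
    omega
  rw [h3, Finset.mul_sum]
  refine Finset.sum_le_sum fun j _ => ?_
  rw [← Finset.sum_mul]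
  refine mul_le_mul_of_nonneg_right ?_ (resolvent_nonneg hl hb j)
  rw [Finset.sum_Ico_eq_sum_range]
  have h4 : ∀ k, j + k + 1 - j = k + 1 := fun k => by omega
  simp only [h4]
  exact hs.sum_le_tsum _ fun k _ => hb _ (by omega)

theorem summable_resolvent {l : ℝ} {b : ℕ → ℝ} (hl : 0 ≤ l) (hb : ∀ j, 1 ≤ j → 0 ≤ b j)
    (hs : Summable fun j : ℕ => b (j + 1)) (h1 : l * ∑' j : ℕ, b (j + 1) < 1) :
    Summable (resolvent l b) := by
  have hz := resolvent_nonneg hl hb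
  have hB : 0 ≤ l * ∑' j : ℕ, b (j + 1) := mul_nonneg hl (tsum_nonneg fun j => hb _ (by omega))
  refine summable_of_sum_range_le (c := 1 / (1 - l * ∑' j : ℕ, b (j + 1))) hz fun N => ?_
  rw [le_div_iff₀ (by linarith)]
  have h := sum_resolvent_le hl hb hs N
  rw [Finset.sum_range_succ] at h
  have := hz N
  linarith

/-- If `l ∑_{j ≥ 1} b(j) < 1`, then `∑_{j ≥ 0} z(j) x ^ j = 1 / (1 - l ∑_{j ≥ 1} b(j) x ^ j)` for
all complex `x` with `‖x‖ ≤ 1`. -/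
theorem hasSum_resolvent {l : ℝ} {b : ℕ → ℝ} (hl : 0 ≤ l) (hb : ∀ j, 1 ≤ j → 0 ≤ b j)
    (hs : Summable fun j : ℕ => b (j + 1)) (h1 : l * ∑' j : ℕ, b (j + 1) < 1)
    (x : ℂ) (hx : ‖x‖ ≤ 1) :
    HasSum (fun j => (resolvent l b j : ℂ) * x ^ j)
      (1 / (1 - (l : ℂ) * ∑' j : ℕ, (b (j + 1) : ℂ) * x ^ (j + 1))) := by
  have hpow : ∀ n, ‖x ^ n‖ ≤ 1 := fun n => by
    rw [norm_pow]; exact pow_le_one₀ (norm_nonneg _) hx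
  have hz := resolvent_nonneg hl hb
  have hzs : Summable fun j => ‖(resolvent l b j : ℂ) * x ^ j‖ := by
    refine Summable.of_nonneg_of_le (fun _ => norm_nonneg _) (fun j => ?_)
      (summable_resolvent hl hb hs h1)
    rw [norm_mul, Complex.norm_real, Real.norm_of_nonneg (hz j)]
    exact mul_le_of_le_one_right (hz j) (hpow j)
  have hbs : Summable fun j : ℕ => ‖(b (j + 1) : ℂ) * x ^ (j + 1)‖ := by
    refine Summable.of_nonneg_of_le (fun _ => norm_nonneg _) (fun j => ?_) hs
    rw [norm_mul, Complex.norm_real, Real.norm_of_nonneg (hb _ (by omega))]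
    exact mul_le_of_le_one_right (hb _ (by omega)) (hpow _)
  have hc : ∀ j, ((PowerSeries.coeff (j + 1) (symbol l b) : ℝ) : ℂ) * x ^ (j + 1) =
      -(l : ℂ) * ((b (j + 1) : ℂ) * x ^ (j + 1)) := fun j => by
    simp [symbol, PowerSeries.coeff_one, mul_assoc]
  have hc0 : PowerSeries.coeff 0 (symbol l b) = 1 := by simp [symbol]
  have hψs : Summable fun j => ‖((PowerSeries.coeff j (symbol l b) : ℝ) : ℂ) * x ^ j‖ := by
    rw [← summable_nat_add_iff 1]
    simp only [hc, norm_mul (-(l : ℂ))]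
    exact hbs.mul_left _
  have hψ : ∑' j, ((PowerSeries.coeff j (symbol l b) : ℝ) : ℂ) * x ^ j =
      1 - (l : ℂ) * ∑' j : ℕ, (b (j + 1) : ℂ) * x ^ (j + 1) := by
    rw [hψs.of_norm.tsum_eq_zero_add, hc0]
    simp only [hc, tsum_mul_left]
    simp [sub_eq_add_neg]
  have hprod := tsum_mul_tsum_eq_tsum_sum_antidiagonal_of_summable_norm hψs hzs
  have hone : ∀ n : ℕ, ∑ p ∈ Finset.HasAntidiagonal.antidiagonal n,
      ((PowerSeries.coeff p.1 (symbol l b) : ℝ) : ℂ) * x ^ p.1 *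
        ((resolvent l b p.2 : ℂ) * x ^ p.2) = if n = 0 then 1 else 0 := fun n => by
    have h := congrArg (fun y : ℝ => (y : ℂ) * x ^ n)
      (congrArg (PowerSeries.coeff n) (symbol_mul_inv l b))
    simp only [PowerSeries.coeff_mul, PowerSeries.coeff_one, Complex.ofReal_sum,
      Complex.ofReal_mul, Finset.sum_mul] at h
    rw [show (if n = 0 then (1 : ℂ) else 0) = ((if n = 0 then (1 : ℝ) else 0 : ℝ) : ℂ) * x ^ n by
      split_ifs with h0 <;> simp [h0], ← h]
    refine Finset.sum_congr rfl fun p hp => ?_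
    rw [← Finset.HasAntidiagonal.mem_antidiagonal.1 hp, pow_add, resolvent]
    ring
  simp only [hone, tsum_ite_eq, hψ] at hprod
  have hval := eq_div_of_mul_eq (left_ne_zero_of_mul (hprod ▸ one_ne_zero))
    ((mul_comm _ _).trans hprod)
  rw [← hval]
  exact hzs.of_norm.hasSum

end ARCH

namespace ARCH

/-! ### Renewal sequences and the weight classes -/

/-! Let l be the shock mean and ς the volatility. Inverting ψ turns the equations into a moving
average: up to a constant, X(k) is ∑ z(j) e(k-j), where e(k) = (ξ(k) - l) ς(k) is bounded in L². If
the e(k) are orthogonal, ρ(n) is at most ∑ z(i) z(n+i) ‖e(-i)‖². Since z is summable, a bound of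
z(n+i) by a multiple of γ(n) suffices: `exists_resolvent_le` gives z ≤ Cγ by the subexponential
behaviour of γ, and near-monotonicity gives γ(n+i) ≤ Dγ(n).

Orthogonality is the hard point: ς(k) must depend only on shocks before time k, which weak
stationarity does not assert. Put w = z/l; the moving average becomes ς(k) = c + ∑_{j ≥ 1} w(j)
(ξ(k-j) - l) ς(k-j). Unrolled to a horizon N, this expresses ς(k) as c ∑_{s<N} R(s), with R(s)
polynomial in past shocks, plus a remainder ∑_{s<N} R(s) tail(N-s). The tails may depend on any
shock, so only Cauchy–Schwarz is available, and the remainder vanishes in L¹ once ∑ ‖R(s)‖₂ < ∞.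

The numbers ‖R(s)‖₂² form a renewal sequence with kernel σ²w², whose mass is below 1 by the
stationarity condition. As ∑ w < ∞, `summable_sqrt_renewal` yields summable square roots. -/

theorem MemWDown.exists_add_le {r : ℝ} {γ : ℕ → ℝ} (h : MemWDown r γ) :
    ∃ C : ℝ, 0 < C ∧ ∀ n j, γ (n + j) ≤ C * γ n := by
  obtain ⟨g, g0, gmono, hg⟩ := h.asymp
  have hanti : Antitone g := antitone_nat_of_succ_le gmono
  -- A convergent sequence is bounded, so γ and g are comparable at every index, not only
  -- asymptotically.
  obtain ⟨A, hA⟩ := hg.bddAbove_range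
  have hg' : Tendsto (fun n => g n / γ n) atTop (𝓝 1) := by
    simpa using hg.inv₀ one_ne_zero
  obtain ⟨B, hB⟩ := hg'.bddAbove_range
  have hA' : ∀ n, γ n ≤ A * g n := fun n => (div_le_iff₀ (g0 n)).1 (hA ⟨n, rfl⟩)
  have hB' : ∀ n, g n ≤ B * γ n := fun n => (div_le_iff₀ (h.pos n)).1 (hB ⟨n, rfl⟩)
  have A0 : 0 < A := pos_of_mul_pos_left ((h.pos 0).trans_le (hA' 0)) (g0 0).le
  have B0 : 0 < B := pos_of_mul_pos_left ((g0 0).trans_le (hB' 0)) (h.pos 0).le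
  refine ⟨A * B, by positivity, fun n j => ?_⟩
  calc γ (n + j) ≤ A * g (n + j) := hA' _
    _ ≤ A * g n := by gcongr; exact hanti (Nat.le_add_right n j)
    _ ≤ A * (B * γ n) := by gcongr; exact hB' n
    _ = A * B * γ n := by ring

theorem MemW.tendsto_sub_ratio {r : ℝ} {γ : ℕ → ℝ} (h : MemW r γ) (i : ℕ) :
    Tendsto (fun n => γ (n - i) / γ n) atTop (𝓝 ((r ^ i)⁻¹)) := by
  rw [← tendsto_add_atTop_iff_nat i]
  simp only [Nat.add_sub_cancel]
  induction i with
  | zero => simpa using tendsto_const_nhds.congr fun n => (div_self (h.pos n).ne').symm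
  | succ i ih =>
    have h1 := ih.mul ((tendsto_add_atTop_iff_nat i).2 h.tendsto_ratio)
    rw [one_div, ← mul_inv, ← pow_succ] at h1
    refine h1.congr fun n => ?_
    have := (h.pos (n + i)).ne'
    rw [← add_assoc]
    field_simp

theorem MemW.exists_eventually_sum_le {r : ℝ} {γ : ℕ → ℝ} (h : MemW r γ) {ε : ℝ} (hε : 0 < ε) :
    ∃ m : ℕ, 1 ≤ m ∧ ∀ᶠ n in atTop, ∑ i ∈ Finset.Icc m (n - m), γ (n - i) * γ i ≤ ε * γ n := by
  have h1 := h.tendsto_limsup.eventually_lt_const (ENNReal.ofReal_pos.2 hε)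
  obtain ⟨m, hm, hm1⟩ := (h1.and (eventually_ge_atTop 1)).exists
  refine ⟨m, hm1, ?_⟩
  filter_upwards [eventually_lt_of_limsup_lt hm] with n hn
  have := (ENNReal.ofReal_lt_ofReal_iff hε).1 hn
  have hp := h.pos n
  rw [one_div, inv_mul_lt_iff₀ hp] at this
  linarith

theorem resolvent_eq_sum {l : ℝ} {b : ℕ → ℝ} {n : ℕ} (hn : 0 < n) :
    resolvent l b n = l * ∑ i ∈ Finset.range n, b (n - i) * resolvent l b i := by
  obtain ⟨k, rfl⟩ := Nat.exists_eq_succ_of_ne_zero hn.ne'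
  exact resolvent_succ l b k

/-- A weight in `𝒲(r)` that dominates the kernel dominates its resolvent sequence. -/
theorem exists_resolvent_le {l r : ℝ} {b γ : ℕ → ℝ} (hl : 0 ≤ l) (hb : ∀ j, 1 ≤ j → 0 ≤ b j)
    (hr : 0 < r) (hs : Summable fun j : ℕ => b (j + 1) * (r ^ (j + 1))⁻¹)
    (h1 : l * ∑' j : ℕ, b (j + 1) * (r ^ (j + 1))⁻¹ < 1) (hγ : MemW r γ)
    (hbγ : ∀ n, 1 ≤ n → b n ≤ γ n) :
    ∃ C : ℝ, 0 < C ∧ ∀ n, resolvent l b n ≤ C * γ n := by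
  set β := ∑' j : ℕ, b (j + 1) * (r ^ (j + 1))⁻¹ with hβ
  have hz := resolvent_nonneg hl hb
  -- One ε pays for the middle block of the convolution, the other for the limit defining the last
  -- block.
  obtain ⟨ε, ε0, hε⟩ : ∃ ε : ℝ, 0 < ε ∧ l * (β + 2 * ε) < 1 := by
    refine ⟨(1 - l * β) / (2 * l + 1) / 2, by have : 0 < 1 - l * β := by linarith
                                              positivity, ?_⟩
    have : l * (β + 2 * ((1 - l * β) / (2 * l + 1) / 2)) =
      l * β + (1 - l * β) * (l / (2 * l + 1)) := by field_simp
    rw [this]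
    have h2 : l / (2 * l + 1) < 1 := by rw [div_lt_one (by positivity)]; linarith
    nlinarith
  obtain ⟨m, hm1, hm⟩ := hγ.exists_eventually_sum_le ε0
  have hD : ∀ᶠ n in atTop, ∑ j ∈ Finset.range (m - 1), b (j + 1) * (γ (n - (j + 1)) / γ n)
      < β + ε := by
    refine (tendsto_finsetSum _ fun j _ =>
      (hγ.tendsto_sub_ratio (j + 1)).const_mul (b (j + 1))).eventually_lt_const ?_
    have : ∑ j ∈ Finset.range (m - 1), b (j + 1) * (r ^ (j + 1))⁻¹ ≤ β :=
      hs.sum_le_tsum _ fun j _ => mul_nonneg (hb _ (by omega)) (by positivity)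
    linarith
  have hA : ∀ᶠ n in atTop, ∑ i ∈ Finset.range m, (γ (n - i) / γ n) * resolvent l b i
      < ∑ i ∈ Finset.range m, (r ^ i)⁻¹ * resolvent l b i + 1 :=
    (tendsto_finsetSum _ fun i _ =>
      (hγ.tendsto_sub_ratio i).mul_const (resolvent l b i)).eventually_lt_const (lt_add_one _)
  set K := ∑ i ∈ Finset.range m, (r ^ i)⁻¹ * resolvent l b i + 1 with hK
  have K0 : 0 < K := by
    have : 0 ≤ ∑ i ∈ Finset.range m, (r ^ i)⁻¹ * resolvent l b i :=
      Finset.sum_nonneg fun i _ => mul_nonneg (by positivity) (hz i)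
    linarith
  -- The bound 2m + 1 makes [0, m), [m, n-m] and (n-m, n) consecutive blocks.
  obtain ⟨n₀, hn₀⟩ := eventually_atTop.1 (hm.and (hD.and (hA.and (eventually_ge_atTop (2 * m + 1)))))
  set θ := l * (β + 2 * ε) with hθ
  -- The finite sum covers n < n₀; the second term ensures lK + Cθ ≤ C, which closes the induction.
  set C := ∑ i ∈ Finset.range n₀, resolvent l b i / γ i + l * K / (1 - θ) + 1 with hC
  have hsum0 : ∀ i ∈ Finset.range n₀, 0 ≤ resolvent l b i / γ i := fun i _ =>
    div_nonneg (hz i) (hγ.pos i).le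
  have hCK : l * K / (1 - θ) ≤ C := by linarith [Finset.sum_nonneg hsum0]
  have hKθ : 0 ≤ l * K / (1 - θ) := div_nonneg (by positivity) (by linarith)
  have C0 : 0 < C := by linarith [Finset.sum_nonneg hsum0]
  refine ⟨C, C0, fun n => ?_⟩
  induction n using Nat.strong_induction_on with
  | _ n ih =>
    have hp := hγ.pos n
    rcases lt_or_ge n n₀ with hn | hn
    · rw [← div_le_iff₀ hp]
      have := Finset.single_le_sum hsum0 (Finset.mem_range.2 hn)
      linarith
    obtain ⟨h2, h3, h4, h5⟩ := hn₀ n hn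
    -- This block avoids the induction hypothesis, so its bound does not involve C.
    have e1 : ∑ i ∈ Finset.Ico 0 m, b (n - i) * resolvent l b i ≤ K * γ n := by
      rw [← Finset.range_eq_Ico]
      refine le_trans ?_ (mul_le_mul_of_nonneg_right h4.le hp.le)
      rw [Finset.sum_mul]
      refine Finset.sum_le_sum fun i hi => ?_
      have := Finset.mem_range.1 hi
      rw [mul_right_comm, div_mul_cancel₀ _ hp.ne']
      exact mul_le_mul_of_nonneg_right (hbγ _ (by omega)) (hz i)
    have e2 : ∑ i ∈ Finset.Ico m (n - m + 1), b (n - i) * resolvent l b i ≤ C * (ε * γ n) := by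
      refine le_trans ?_ (mul_le_mul_of_nonneg_left h2 C0.le)
      rw [Finset.mul_sum]
      refine Finset.sum_le_sum fun i hi => ?_
      have := Finset.mem_Ico.1 hi
      calc b (n - i) * resolvent l b i ≤ γ (n - i) * (C * γ i) :=
            mul_le_mul (hbγ _ (by omega)) (ih i (by omega)) (hz i) (hγ.pos _).le
        _ = C * (γ (n - i) * γ i) := by ring
    have e3 : ∑ i ∈ Finset.Ico (n - m + 1) n, b (n - i) * resolvent l b i
        ≤ C * ((β + ε) * γ n) := by
      refine le_trans ?_ (mul_le_mul_of_nonneg_left (mul_le_mul_of_nonneg_right h3.le hp.le) C0.le)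
      -- Reindexed by the lag n - i, which runs from 1 to m - 1.
      rw [Finset.sum_mul, Finset.mul_sum, Finset.sum_Ico_eq_sum_range, ← Finset.sum_range_reflect,
        show n - (n - m + 1) = m - 1 by omega]
      refine Finset.sum_le_sum fun i hi => ?_
      have := Finset.mem_range.1 hi
      rw [show n - (n - m + 1 + (m - 1 - 1 - i)) = i + 1 by omega,
        show n - m + 1 + (m - 1 - 1 - i) = n - (i + 1) by omega, mul_assoc,
        div_mul_cancel₀ _ hp.ne']
      calc b (i + 1) * resolvent l b (n - (i + 1)) ≤ b (i + 1) * (C * γ (n - (i + 1))) :=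
            mul_le_mul_of_nonneg_left (ih _ (by omega)) (hb _ (by omega))
        _ = C * (b (i + 1) * γ (n - (i + 1))) := by ring
    rw [resolvent_eq_sum (by omega), Finset.range_eq_Ico,
      ← Finset.sum_Ico_consecutive _ (Nat.zero_le m) (show m ≤ n by omega),
      ← Finset.sum_Ico_consecutive _ (show m ≤ n - m + 1 by omega) (show n - m + 1 ≤ n by omega)]
    calc _ ≤ l * (K * γ n + (C * (ε * γ n) + C * ((β + ε) * γ n))) := by gcongr
      _ = (l * K + C * θ) * γ n := by rw [hθ]; ring
      _ ≤ C * γ n := by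
        gcongr
        rw [div_le_iff₀ (by linarith)] at hCK
        linarith

/-! ### Summability of the square root of a renewal sequence -/

/-- The total mass `∑ coeff n F` of a power series with coefficients in `[0, ∞]`. -/
noncomputable def mass (F : PowerSeries ℝ≥0∞) : ℝ≥0∞ := ∑' n, PowerSeries.coeff n F

/-- The sum `∑ (coeff n F) ^ (1 / 2)` over the coefficients of a power series. -/
noncomputable def rootMass (F : PowerSeries ℝ≥0∞) : ℝ≥0∞ :=
  ∑' n, PowerSeries.coeff n F ^ (1 / 2 : ℝ)

theorem tsum_sum_antidiagonal (f g : ℕ → ℝ≥0∞) :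
    ∑' n, ∑ p ∈ Finset.HasAntidiagonal.antidiagonal n, f p.1 * g p.2 =
      (∑' n, f n) * ∑' n, g n := by
  simp_rw [← ENNReal.tsum_mul_right, ← ENNReal.tsum_mul_left]
  rw [← ENNReal.tsum_prod' (f := fun p : ℕ × ℕ => f p.1 * g p.2),
    ← Finset.HasAntidiagonal.sigmaAntidiagonalEquivProd.tsum_eq, ENNReal.tsum_sigma']
  refine tsum_congr fun n => ?_
  rw [tsum_fintype, ← Finset.sum_coe_sort]
  rfl

theorem mass_mul (F G : PowerSeries ℝ≥0∞) : mass (F * G) = mass F * mass G := by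
  simp only [mass, PowerSeries.coeff_mul]
  exact tsum_sum_antidiagonal (fun n => PowerSeries.coeff n F) fun n => PowerSeries.coeff n G

theorem mass_one : mass 1 = 1 := by simp [mass, PowerSeries.coeff_one]

theorem mass_pow (F : PowerSeries ℝ≥0∞) (k : ℕ) : mass (F ^ k) = mass F ^ k := by
  induction k with
  | zero => simp [mass_one]
  | succ k ih => rw [pow_succ, pow_succ, mass_mul, ih]

theorem rpow_half_sum_le {ι : Type*} (s : Finset ι) (f : ι → ℝ≥0∞) :
    (∑ i ∈ s, f i) ^ (1 / 2 : ℝ) ≤ ∑ i ∈ s, f i ^ (1 / 2 : ℝ) := by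
  induction s using Finset.cons_induction with
  | empty => simp
  | cons i s hi ih =>
    rw [Finset.sum_cons, Finset.sum_cons]
    exact (ENNReal.rpow_add_le_add_rpow _ _ (by norm_num) (by norm_num)).trans (by gcongr)

theorem rpow_half_tsum_le (f : ℕ → ℝ≥0∞) :
    (∑' i, f i) ^ (1 / 2 : ℝ) ≤ ∑' i, f i ^ (1 / 2 : ℝ) := by
  refine le_of_tendsto ((ENNReal.continuous_rpow_const.tendsto _).comp
    (ENNReal.summable (f := f)).hasSum) (Eventually.of_forall fun s => ?_)
  exact (rpow_half_sum_le s f).trans (ENNReal.sum_le_tsum s)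

/-- Subadditivity of the square root, applied to each coefficient of the convolution. -/
theorem rootMass_mul_le (F G : PowerSeries ℝ≥0∞) :
    rootMass (F * G) ≤ rootMass F * rootMass G := by
  simp only [rootMass, PowerSeries.coeff_mul]
  rw [← tsum_sum_antidiagonal (fun n => PowerSeries.coeff n F ^ (1 / 2 : ℝ))
    fun n => PowerSeries.coeff n G ^ (1 / 2 : ℝ)]
  refine ENNReal.tsum_le_tsum fun n => (rpow_half_sum_le _ _).trans_eq ?_
  exact Finset.sum_congr rfl fun p _ => ENNReal.mul_rpow_of_nonneg _ _ (by norm_num)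

theorem rootMass_sum_le {ι : Type*} (s : Finset ι) (F : ι → PowerSeries ℝ≥0∞) :
    rootMass (∑ i ∈ s, F i) ≤ ∑ i ∈ s, rootMass (F i) := by
  simp only [rootMass, map_sum]
  rw [← Summable.tsum_finsetSum fun _ _ => ENNReal.summable]
  exact ENNReal.tsum_le_tsum fun n => rpow_half_sum_le _ _

theorem rootMass_natCast_le (n : ℕ) : rootMass (n : PowerSeries ℝ≥0∞) ≤ n := by
  have h : rootMass (1 : PowerSeries ℝ≥0∞) = 1 := by
    rw [rootMass, tsum_eq_single 0]
    · simp
    · intro k hk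
      simp [PowerSeries.coeff_one, hk]
  have := rootMass_sum_le (Finset.range n) fun _ => (1 : PowerSeries ℝ≥0∞)
  simpa [h] using this

theorem rootMass_pow_le (F : PowerSeries ℝ≥0∞) (k : ℕ) :
    rootMass (F ^ k) ≤ rootMass F ^ k := by
  induction k with
  | zero => simpa using rootMass_natCast_le 1
  | succ k ih =>
    rw [pow_succ, pow_succ]
    exact (rootMass_mul_le _ _).trans (by gcongr)

theorem coeff_pow_eq_zero {F : PowerSeries ℝ≥0∞} {J : ℕ}
    (hF : ∀ n, J < n → PowerSeries.coeff n F = 0) (k : ℕ) :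
    ∀ n, k * J < n → PowerSeries.coeff n (F ^ k) = 0 := by
  induction k with
  | zero =>
    intro n hn
    rw [pow_zero, PowerSeries.coeff_one, if_neg (by omega)]
  | succ k ih =>
    intro n hn
    rw [pow_succ, PowerSeries.coeff_mul]
    refine Finset.sum_eq_zero fun p hp => ?_
    have hp := Finset.HasAntidiagonal.mem_antidiagonal.1 hp
    rcases lt_or_ge (k * J) p.1 with h | h
    · rw [ih _ h, zero_mul]
    · rw [hF _ (by rw [add_mul] at hn; omega), mul_zero]

theorem rootMass_le_of_coeff_eq_zero {F : PowerSeries ℝ≥0∞} {D : ℕ}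
    (hF : ∀ n, D < n → PowerSeries.coeff n F = 0) :
    rootMass F ≤ (D + 1) * mass F ^ (1 / 2 : ℝ) := by
  rw [rootMass, tsum_eq_sum (s := Finset.range (D + 1))]
  · have : ∀ n ∈ Finset.range (D + 1), PowerSeries.coeff n F ^ (1 / 2 : ℝ) ≤
        mass F ^ (1 / 2 : ℝ) := fun n _ =>
      ENNReal.rpow_le_rpow (ENNReal.le_tsum n) (by norm_num)
    simpa using Finset.sum_le_sum this
  · intro n hn
    rw [hF n (by simpa using hn)]
    simp

/-- The root mass of F may exceed 1, so its powers are useless. A power of a polynomial has root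
mass at most its number of coefficients times the square root of its mass, so the degree costs only
a factor linear in m. -/
theorem rootMass_add_pow_le {F G : PowerSeries ℝ≥0∞} {J : ℕ}
    (hF : ∀ n, J < n → PowerSeries.coeff n F = 0) (m : ℕ) :
    rootMass ((F + G) ^ m) ≤
      (m * J + 1) * (mass F ^ (1 / 2 : ℝ) + rootMass G) ^ m := by
  rw [add_pow, add_pow, Finset.mul_sum]
  refine (rootMass_sum_le _ _).trans (Finset.sum_le_sum fun k hk => ?_)
  have hk : k ≤ m := by have := Finset.mem_range.1 hk; omega
  have h1 : rootMass (F ^ k) ≤ (m * J + 1) * (mass F ^ (1 / 2 : ℝ)) ^ k := by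
    refine (rootMass_le_of_coeff_eq_zero (coeff_pow_eq_zero hF k)).trans ?_
    rw [mass_pow, ← ENNReal.rpow_natCast, ← ENNReal.rpow_natCast, ← ENNReal.rpow_mul,
      ← ENNReal.rpow_mul, mul_comm (k : ℝ)]
    gcongr
    exact_mod_cast Nat.mul_le_mul_right J hk
  calc _ ≤ rootMass (F ^ k) * rootMass (G ^ (m - k)) * rootMass ((m.choose k : ℕ) : PowerSeries ℝ≥0∞) :=
        (rootMass_mul_le _ _).trans (by gcongr; exact rootMass_mul_le _ _)
    _ ≤ ((m * J + 1) * (mass F ^ (1 / 2 : ℝ)) ^ k) * rootMass G ^ (m - k) * (m.choose k : ℕ) := by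
        gcongr
        · exact rootMass_pow_le _ _
        · exact rootMass_natCast_le _
    _ = _ := by ring

theorem tsum_rootMass_pow_ne_top {F : PowerSeries ℝ≥0∞} (h1 : mass F < 1)
    (h2 : rootMass F ≠ ∞) : ∑' m : ℕ, rootMass (F ^ m) ≠ ∞ := by
  have hα : mass F ^ (1 / 2 : ℝ) < 1 := ENNReal.rpow_lt_one h1 (by norm_num)
  have htail := ENNReal.tendsto_sum_nat_add (fun n => PowerSeries.coeff n F ^ (1 / 2 : ℝ)) h2
  obtain ⟨δ, hδ, hδ'⟩ := ENNReal.lt_iff_exists_add_pos_lt.1 hα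
  -- Truncation at J leaves a tail whose root mass fits in the gap δ, so the base θ below is less
  -- than 1.
  obtain ⟨J, hJ⟩ := (htail.eventually_lt_const (ENNReal.coe_pos.2 hδ)).exists
  obtain ⟨F₁, hF₁c⟩ : ∃ G : PowerSeries ℝ≥0∞, ∀ n, PowerSeries.coeff n G =
      if n < J then PowerSeries.coeff n F else 0 := ⟨_, fun n => PowerSeries.coeff_mk n _⟩
  obtain ⟨F₂, hF₂c⟩ : ∃ G : PowerSeries ℝ≥0∞, ∀ n, PowerSeries.coeff n G =
      if n < J then 0 else PowerSeries.coeff n F := ⟨_, fun n => PowerSeries.coeff_mk n _⟩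
  have hF : F = F₁ + F₂ := by
    ext n
    rw [map_add, hF₁c, hF₂c]
    split_ifs <;> simp
  have hF₁ : mass F₁ ≤ mass F := ENNReal.tsum_le_tsum fun n => by
    rw [hF₁c]
    split_ifs
    · exact le_rfl
    · exact zero_le
  have hF₂ : rootMass F₂ < δ := by
    refine lt_of_eq_of_lt ?_ hJ
    rw [rootMass, ← (ENNReal.summable).sum_add_tsum_nat_add' (k := J),
      Finset.sum_eq_zero, zero_add]
    · exact tsum_congr fun n => by rw [hF₂c, if_neg (by omega)]
    · intro n hn
      rw [hF₂c, if_pos (Finset.mem_range.1 hn), ENNReal.zero_rpow_of_pos (by norm_num)]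
  set θ := mass F₁ ^ (1 / 2 : ℝ) + rootMass F₂ with hθ
  have hθ1 : θ < 1 := lt_of_le_of_lt
    (add_le_add (ENNReal.rpow_le_rpow hF₁ (by norm_num)) hF₂.le) hδ'
  have hθt : θ ≠ ∞ := (hθ1.trans ENNReal.one_lt_top).ne
  have hb : ∀ m : ℕ, rootMass (F ^ m) ≤ ENNReal.ofReal ((m * J + 1) * θ.toReal ^ m) := fun m => by
    rw [hF]
    refine (rootMass_add_pow_le (J := J) (fun n hn => ?_) m).trans_eq ?_
    · rw [hF₁c, if_neg hn.not_gt]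
    · rw [ENNReal.ofReal_mul (by positivity), ENNReal.ofReal_pow ENNReal.toReal_nonneg,
        ENNReal.ofReal_toReal hθt]
      congr 1
      rw [ENNReal.ofReal_add (by positivity) zero_le_one, ENNReal.ofReal_one,
        ENNReal.ofReal_mul (by positivity), ENNReal.ofReal_natCast, ENNReal.ofReal_natCast]
  have hr : ‖θ.toReal‖ < 1 := by
    rw [Real.norm_of_nonneg ENNReal.toReal_nonneg]
    exact (ENNReal.toReal_lt_of_lt_ofReal (by simpa using hθ1))
  have hs : Summable fun m : ℕ => ((m : ℝ) * J + 1) * θ.toReal ^ m := by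
    have s1 := (summable_pow_mul_geometric_of_norm_lt_one 1 hr).mul_left (J : ℝ)
    have s2 := summable_geometric_of_norm_lt_one hr
    refine (s1.add s2).congr fun m => by ring
  exact ne_top_of_le_ne_top hs.tsum_ofReal_ne_top (ENNReal.tsum_le_tsum hb)

/-- If `u 0 = 1` and `u s = ∑_{t < s} f (s - t) u t` with `f ≥ 0`, `∑ f < 1` and `∑ √f < ∞`, then
`∑ √u < ∞`. -/
theorem summable_sqrt_renewal {f u : ℕ → ℝ} (hf : ∀ n, 0 ≤ f (n + 1))
    (hs : Summable fun n => √(f (n + 1))) (h1 : ∑' n, f (n + 1) < 1) (u0 : u 0 = 1)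
    (hu : ∀ s, u (s + 1) = ∑ t ∈ Finset.range (s + 1), f (s + 1 - t) * u t) :
    Summable fun n => √(u n) := by
  have hsf : Summable fun n => f (n + 1) := by
    refine ((hs.mul_of_nonneg hs (fun n => Real.sqrt_nonneg _) fun n => Real.sqrt_nonneg _).comp_injective
      (i := fun n => (n, n)) fun m n h => congrArg Prod.fst h).congr fun n => Real.mul_self_sqrt (hf n)
  have hf' : ∀ n, 1 ≤ n → 0 ≤ f n := fun n hn => by
    obtain ⟨k, rfl⟩ := Nat.exists_eq_succ_of_ne_zero (show n ≠ 0 by omega)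
    exact hf k
  have hu0 : ∀ n, 0 ≤ u n := fun n => by
    induction n using Nat.strong_induction_on with
    | _ n ih =>
      cases n with
      | zero => rw [u0]; exact zero_le_one
      | succ n =>
        rw [hu]
        refine Finset.sum_nonneg fun t ht => ?_
        have := Finset.mem_range.1 ht
        exact mul_nonneg (hf' _ (by omega)) (ih t this)
  obtain ⟨F, hF0, hF⟩ : ∃ F : PowerSeries ℝ≥0∞, PowerSeries.coeff 0 F = 0 ∧
      ∀ n, PowerSeries.coeff (n + 1) F = ENNReal.ofReal (f (n + 1)) :=
    ⟨PowerSeries.mk fun n => if n = 0 then 0 else ENNReal.ofReal (f n),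
      PowerSeries.coeff_mk _ _, fun n => PowerSeries.coeff_mk _ _⟩
  have hF1 : mass F < 1 := by
    rw [mass, tsum_eq_zero_add' ENNReal.summable, hF0, zero_add, tsum_congr hF,
      ← ENNReal.ofReal_tsum_of_nonneg hf hsf]
    exact ENNReal.ofReal_lt_one.2 h1
  have hF2 : rootMass F ≠ ∞ := by
    rw [rootMass, tsum_eq_zero_add' ENNReal.summable, hF0,
      ENNReal.zero_rpow_of_pos (by norm_num), zero_add]
    refine ne_top_of_le_ne_top hs.tsum_ofReal_ne_top (ENNReal.tsum_le_tsum fun n => ?_)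
    rw [hF, ENNReal.ofReal_rpow_of_nonneg (hf n) (by norm_num), Real.sqrt_eq_rpow]
  -- Formally u is the geometric series ∑ F^m; only this inequality is needed.
  have hle : ∀ n, ENNReal.ofReal (u n) ≤ ∑' m : ℕ, PowerSeries.coeff n (F ^ m) := fun n => by
    induction n using Nat.strong_induction_on with
    | _ n ih =>
      cases n with
      | zero =>
        refine le_trans ?_ (ENNReal.le_tsum 0)
        simp [u0]
      | succ n =>
        rw [tsum_eq_zero_add' ENNReal.summable]
        refine le_trans ?_ le_add_self
        simp only [pow_succ, PowerSeries.coeff_mul]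
        rw [Summable.tsum_finsetSum fun _ _ => ENNReal.summable,
          Finset.Nat.sum_antidiagonal_eq_sum_range_succ_mk, Finset.sum_range_succ]
        refine le_trans ?_ le_self_add
        rw [hu, ENNReal.ofReal_sum_of_nonneg fun t ht => mul_nonneg
          (hf' _ (by have := Finset.mem_range.1 ht; omega)) (hu0 t)]
        refine Finset.sum_le_sum fun t ht => ?_
        have := Finset.mem_range.1 ht
        rw [ENNReal.tsum_mul_right, mul_comm, ENNReal.ofReal_mul (hu0 t)]
        refine mul_le_mul' (ih t this) ?_
        rw [show n + 1 - t = n - t + 1 by omega, hF]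
  have hfin : ∑' n, ENNReal.ofReal (√(u n)) ≠ ∞ := by
    refine ne_top_of_le_ne_top (tsum_rootMass_pow_ne_top hF1 hF2) ?_
    simp only [rootMass]
    rw [ENNReal.tsum_comm]
    refine ENNReal.tsum_le_tsum fun n => ?_
    rw [Real.sqrt_eq_rpow, ← ENNReal.ofReal_rpow_of_nonneg (hu0 n) (by norm_num)]
    exact (ENNReal.rpow_le_rpow (hle n) (by norm_num)).trans (rpow_half_tsum_le _)
  refine (ENNReal.summable_toReal hfin).congr fun n => ENNReal.toReal_ofReal (Real.sqrt_nonneg _)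

/-! ### The chaos expansion of the volatility -/

/-- The sequence `R 0 = 1`, `R s = y s * ∑_{t < s} w (s - t) * R t`. -/
noncomputable def chain (w y : ℕ → ℝ) : ℕ → ℝ
  | 0 => 1
  | s + 1 => y (s + 1) * ∑ t : Fin (s + 1), w (s + 1 - t) * chain w y t

theorem chain_zero (w y : ℕ → ℝ) : chain w y 0 = 1 := by rw [chain]

theorem chain_eq (w y : ℕ → ℝ) {s : ℕ} (hs : 0 < s) :
    chain w y s = y s * ∑ t ∈ Finset.range s, w (s - t) * chain w y t := by
  obtain ⟨s, rfl⟩ := Nat.exists_eq_succ_of_ne_zero hs.ne'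
  rw [chain, Finset.sum_range]

/-- Unrolling a linear Volterra recursion down to a finite horizon. -/
theorem sum_chain_mul_sub (w y v : ℕ → ℝ) {N : ℕ} (hN : 0 < N) :
    ∑ s ∈ Finset.range N, chain w y s *
      (v s - ∑ t ∈ Finset.Ico (s + 1) N, w (t - s) * (y t * v t)) = v 0 := by
  have h : ∑ s ∈ Finset.range N, ∑ t ∈ Finset.Ico (s + 1) N,
      chain w y s * (w (t - s) * (y t * v t)) =
      ∑ t ∈ Finset.range N, ∑ s ∈ Finset.range t, chain w y s * (w (t - s) * (y t * v t)) :=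
    Finset.sum_comm' fun s t => by simp only [Finset.mem_range, Finset.mem_Ico]; omega
  simp only [mul_sub, Finset.sum_sub_distrib, Finset.mul_sum]
  -- After the exchange of sums, the coefficient of v(t) vanishes for t > 0 by the recursion for
  -- `chain`.
  rw [h, ← Finset.sum_sub_distrib, Finset.sum_eq_single_of_mem 0 (Finset.mem_range.2 hN)]
  · simp [chain_zero]
  · intro t _ ht
    rw [chain_eq w y (Nat.pos_of_ne_zero ht), Finset.mul_sum, Finset.sum_mul, sub_eq_zero]
    exact Finset.sum_congr rfl fun s _ => by ring

section Probability

variable {Ω : Type*} {mΩ : MeasurableSpace Ω} {P : Measure Ω} {ξ : ℤ → Ω → ℝ}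

/-- The σ-algebra generated by the `ξ i` with `i ∈ S`. -/
@[reducible]
def sigmaOn (ξ : ℤ → Ω → ℝ) (S : Set ℤ) : MeasurableSpace Ω :=
  ⨆ i ∈ S, MeasurableSpace.comap (ξ i) inferInstance

theorem sigmaOn_mono {S T : Set ℤ} (h : S ⊆ T) : sigmaOn ξ S ≤ sigmaOn ξ T :=
  biSup_mono h

theorem sigmaOn_le (hm : ∀ k, Measurable (ξ k)) (S : Set ℤ) : sigmaOn ξ S ≤ mΩ :=
  iSup₂_le fun i _ => (hm i).comap_le

theorem measurable_sigmaOn {S : Set ℤ} {i : ℤ} (hi : i ∈ S) : Measurable[sigmaOn ξ S] (ξ i) :=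
  measurable_iff_comap_le.2 (le_iSup₂_of_le i hi le_rfl)

theorem indepFun_of_disjoint (hm : ∀ k, Measurable (ξ k)) (hi : iIndepFun ξ P) {S T : Set ℤ}
    (hST : Disjoint S T) {f g : Ω → ℝ} (hf : Measurable[sigmaOn ξ S] f)
    (hg : Measurable[sigmaOn ξ T] g) : IndepFun f g P := by
  have h := indep_iSup_of_disjoint (fun i => (hm i).comap_le) hi hST
  rw [IndepFun_iff_Indep]
  exact indep_of_indep_of_le_left (indep_of_indep_of_le_right h hg.comap_le) hf.comap_le

theorem memLp_two_mul {f g : Ω → ℝ} (h : IndepFun f g P)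
    (hf : MemLp f 2 P) (hg : MemLp g 2 P) : MemLp (f * g) 2 P := by
  rw [memLp_two_iff_integrable_sq (hf.1.mul hg.1)]
  have h2 : IndepFun (fun ω => f ω ^ 2) (fun ω => g ω ^ 2) P :=
    h.comp (measurable_id.pow_const 2) (measurable_id.pow_const 2)
  refine (h2.integrable_mul hf.integrable_sq hg.integrable_sq).congr (ae_of_all _ fun ω => ?_)
  simp [mul_pow]

variable {l v : ℝ} {w : ℕ → ℝ}

/-- The chaos terms `R(s)` of the volatility at time `k`. -/
noncomputable def chaos (ξ : ℤ → Ω → ℝ) (l : ℝ) (w : ℕ → ℝ) (k : ℤ) (s : ℕ) (ω : Ω) : ℝ :=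
  chain w (fun t => ξ (k - t) ω - l) s

theorem chaos_eq (k : ℤ) {s : ℕ} (hs : 0 < s) :
    chaos ξ l w k s = (fun ω => ξ (k - s) ω - l) *
      fun ω => ∑ t ∈ Finset.range s, w (s - t) * chaos ξ l w k t ω :=
  funext fun _ => chain_eq _ _ hs

theorem measurable_chaos (k : ℤ) (s : ℕ) :
    Measurable[sigmaOn ξ (Set.Ico (k - s) k)] (chaos ξ l w k s) := by
  induction s using Nat.strong_induction_on with
  | _ s ih =>
    rcases Nat.eq_zero_or_pos s with rfl | hs
    · have : chaos ξ l w k 0 = fun _ => 1 := funext fun _ => chain_zero _ _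
      rw [this]
      exact measurable_const
    · rw [chaos_eq k hs]
      refine Measurable.mul ((measurable_sigmaOn (Set.left_mem_Ico.2 (by omega))).sub measurable_const) ?_
      refine Finset.measurable_fun_sum _ fun t ht => Measurable.const_mul ?_ _
      have := Finset.mem_range.1 ht
      exact (ih t this).mono (sigmaOn_mono (Set.Ico_subset_Ico_left (by omega))) le_rfl

/-- The left endpoint k - s + 1 excludes ξ(k-s), so the two factors of R(s) are independent. -/
theorem measurable_sum_chaos (k : ℤ) (s : ℕ) :
    Measurable[sigmaOn ξ (Set.Ico (k - s + 1) k)]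
      (fun ω => ∑ t ∈ Finset.range s, w (s - t) * chaos ξ l w k t ω) := by
  refine Finset.measurable_fun_sum _ fun t ht => Measurable.const_mul ?_ _
  have := Finset.mem_range.1 ht
  exact (measurable_chaos k t).mono (sigmaOn_mono (Set.Ico_subset_Ico_left (by omega))) le_rfl

theorem indepFun_shock (hm : ∀ k, Measurable (ξ k)) (hi : iIndepFun ξ P) {T : Set ℤ} {i : ℤ}
    (hiT : i ∉ T) {g : Ω → ℝ} (hg : Measurable[sigmaOn ξ T] g) :
    IndepFun (fun ω => ξ i ω - l) g P := by
  have h : Measurable[sigmaOn ξ {i}] (ξ i) := measurable_sigmaOn (Set.mem_singleton i)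
  have h' : Measurable[sigmaOn ξ {i}] fun ω => ξ i ω - l := h.sub_const l
  exact indepFun_of_disjoint hm hi (Set.disjoint_singleton_left.2 hiT) h' hg

variable [IsProbabilityMeasure P]

theorem memLp_chaos (hm : ∀ k, Measurable (ξ k)) (hi : iIndepFun ξ P)
    (h2 : ∀ k, MemLp (ξ k) 2 P) (k : ℤ) (s : ℕ) : MemLp (chaos ξ l w k s) 2 P := by
  induction s using Nat.strong_induction_on with
  | _ s ih =>
    rcases Nat.eq_zero_or_pos s with rfl | hs
    · have : chaos ξ l w k 0 = fun _ => 1 := funext fun _ => chain_zero _ _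
      rw [this]
      exact memLp_const _
    · rw [chaos_eq k hs]
      refine memLp_two_mul (indepFun_shock hm hi (fun h => ?_) (measurable_sum_chaos k s))
        ((h2 _).sub (memLp_const _)) ?_
      · have := h.1
        omega
      · exact memLp_finsetSum _ fun t ht => (ih t (Finset.mem_range.1 ht)).const_mul _

/-- The oldest shock ξ(k-t) enters only through a centred factor independent of everything else. -/
theorem integral_chaos_mul_chaos (hm : ∀ k, Measurable (ξ k)) (hi : iIndepFun ξ P)
    (h2 : ∀ k, MemLp (ξ k) 2 P) (h1 : ∀ k, P[ξ k] = l) (k : ℤ) {s t : ℕ} (hst : s < t) :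
    ∫ ω, chaos ξ l w k s ω * chaos ξ l w k t ω ∂P = 0 := by
  have hS := (measurable_chaos (ξ := ξ) (l := l) (w := w) k s).mono
    (sigmaOn_mono (Set.Ico_subset_Ico_left (show k - t + 1 ≤ k - s by omega))) le_rfl
  have hind := indepFun_shock (l := l) (i := k - t) hm hi
    (fun h => by have := h.1; omega) (hS.mul (measurable_sum_chaos (l := l) (w := w) k t))
  have hmeas := (hS.mul (measurable_sum_chaos (l := l) (w := w) k t)).mono (sigmaOn_le hm _) le_rfl
  have h := hind.integral_mul_eq_mul_integral
    ((hm _).sub measurable_const).aestronglyMeasurable hmeas.aestronglyMeasurable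
  rw [integral_sub ((h2 _).integrable one_le_two) (integrable_const _), h1] at h
  simp only [integral_const, probReal_univ, one_smul, sub_self, zero_mul] at h
  rw [← h]
  refine integral_congr_ae (ae_of_all _ fun ω => ?_)
  simp only [chaos_eq k (show 0 < t by omega), Pi.mul_apply]
  ring

theorem integral_chaos_sq (hm : ∀ k, Measurable (ξ k)) (hi : iIndepFun ξ P)
    (h2 : ∀ k, MemLp (ξ k) 2 P) (h1 : ∀ k, P[ξ k] = l) (hv : ∀ k, ∫ ω, (ξ k ω - l) ^ 2 ∂P = v)
    (k : ℤ) {s : ℕ} (hs : 0 < s) :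
    ∫ ω, chaos ξ l w k s ω ^ 2 ∂P =
      ∑ t ∈ Finset.range s, v * w (s - t) ^ 2 * ∫ ω, chaos ξ l w k t ω ^ 2 ∂P := by
  have hL := memLp_chaos (l := l) (w := w) hm hi h2 k
  have hind := (indepFun_shock (l := l) (i := k - s) hm hi
    (fun h => by have := h.1; omega) (measurable_sum_chaos (l := l) (w := w) k s)).comp
    (measurable_id.pow_const 2) (measurable_id.pow_const 2)
  have hmeas := (measurable_sum_chaos (ξ := ξ) (l := l) (w := w) k s).mono (sigmaOn_le hm _) le_rfl
  have h := hind.integral_mul_eq_mul_integral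
    (((hm _).sub measurable_const).pow_const 2).aestronglyMeasurable
    (hmeas.pow_const 2).aestronglyMeasurable
  calc _ = ∫ ω, (ξ (k - s) ω - l) ^ 2 *
        (∑ t ∈ Finset.range s, w (s - t) * chaos ξ l w k t ω) ^ 2 ∂P := by
        refine integral_congr_ae (ae_of_all _ fun ω => ?_)
        simp only [chaos_eq k hs, Pi.mul_apply, mul_pow]
    _ = v * ∫ ω, (∑ t ∈ Finset.range s, w (s - t) * chaos ξ l w k t ω) ^ 2 ∂P := by
        rw [← hv (k - s)]
        exact h
    _ = v * ∑ t ∈ Finset.range s, w (s - t) ^ 2 * ∫ ω, chaos ξ l w k t ω ^ 2 ∂P := by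
        congr 1
        have hint : ∀ i j, Integrable (fun ω => w (s - i) * chaos ξ l w k i ω *
            (w (s - j) * chaos ξ l w k j ω)) P := fun i j =>
          ((hL i).const_mul _).integrable_mul ((hL j).const_mul _)
        simp only [sq, Finset.sum_mul_sum]
        rw [integral_finsetSum _ fun i _ => integrable_finsetSum _ fun j _ => hint i j]
        refine Finset.sum_congr rfl fun i hi' => ?_
        rw [integral_finsetSum _ fun j _ => hint i j, Finset.sum_eq_single_of_mem i hi']
        · rw [← integral_const_mul]
          exact integral_congr_ae (ae_of_all _ fun ω => by ring)
        · intro j _ hji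
          have h0 : ∫ ω, chaos ξ l w k i ω * chaos ξ l w k j ω ∂P = 0 := by
            rcases lt_or_gt_of_ne hji with hlt | hlt
            · rw [← integral_chaos_mul_chaos (w := w) hm hi h2 h1 k hlt]
              exact integral_congr_ae (ae_of_all _ fun ω => mul_comm _ _)
            · exact integral_chaos_mul_chaos hm hi h2 h1 k hlt
          calc _ = ∫ ω, w (s - i) * w (s - j) * (chaos ξ l w k i ω * chaos ξ l w k j ω) ∂P :=
                integral_congr_ae (ae_of_all _ fun ω => by ring)
            _ = 0 := by rw [integral_const_mul, h0, mul_zero]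
    _ = _ := by
        rw [Finset.mul_sum]
        exact Finset.sum_congr rfl fun t _ => by ring

theorem summable_sqrt_integral_chaos_sq (hm : ∀ k, Measurable (ξ k)) (hi : iIndepFun ξ P)
    (h2 : ∀ k, MemLp (ξ k) 2 P) (h1 : ∀ k, P[ξ k] = l) (hv : ∀ k, ∫ ω, (ξ k ω - l) ^ 2 ∂P = v)
    (hv0 : 0 ≤ v) (hw0 : ∀ j, 0 ≤ w j) (hw : Summable fun j => w (j + 1))
    (hw1 : v * ∑' j, w (j + 1) ^ 2 < 1) (k : ℤ) :
    Summable fun s => √(∫ ω, chaos ξ l w k s ω ^ 2 ∂P) := by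
  refine summable_sqrt_renewal (f := fun j => v * w j ^ 2) (fun n => by positivity) ?_ ?_ ?_
    fun s => integral_chaos_sq hm hi h2 h1 hv k (Nat.succ_pos s)
  · refine (hw.mul_left √v).congr fun n => ?_
    rw [Real.sqrt_mul hv0, Real.sqrt_sq (hw0 _)]
  · rwa [tsum_mul_left]
  · simp [chaos, chain_zero]

end Probability

/-! ### Linear filters of bounded sequences -/

section LinearFilter

variable {E : Type*} [NormedAddCommGroup E] [NormedSpace ℝ E]

/-- The linear filter `∑_{j ≥ 0} c j • y (k - j)`. -/
noncomputable def linearFilter (c : ℕ → ℝ) (y : ℤ → E) (k : ℤ) : E :=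
  ∑' j : ℕ, c j • y (k - j)

variable {c d : ℕ → ℝ} {y : ℤ → E} {M : ℝ}

theorem norm_filter_term_le (hy : ∀ k, ‖y k‖ ≤ M) (k : ℤ) (j : ℕ) :
    ‖c j • y (k - j)‖ ≤ ‖c j‖ * M := by
  rw [norm_smul]
  gcongr
  exact hy _

theorem summable_norm_filter (hc : Summable fun j => ‖c j‖) (hy : ∀ k, ‖y k‖ ≤ M) (k : ℤ) :
    Summable fun j : ℕ => ‖c j • y (k - j)‖ :=
  Summable.of_nonneg_of_le (fun _ => norm_nonneg _) (norm_filter_term_le hy k) (hc.mul_right M)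

theorem norm_linearFilter_le (hc : Summable fun j => ‖c j‖) (hy : ∀ k, ‖y k‖ ≤ M) (k : ℤ) :
    ‖linearFilter c y k‖ ≤ (∑' j, ‖c j‖) * M := by
  rw [← tsum_mul_right]
  exact tsum_of_norm_bounded (hc.mul_right M).hasSum (norm_filter_term_le hy k)

theorem linearFilter_linearFilter [CompleteSpace E] (hc : Summable fun j => ‖c j‖)
    (hd : Summable fun j => ‖d j‖) (hy : ∀ k, ‖y k‖ ≤ M) (k : ℤ) :
    linearFilter c (linearFilter d y) k =
      linearFilter (fun n => ∑ p ∈ Finset.HasAntidiagonal.antidiagonal n, c p.1 * d p.2) y k := by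
  have hs : Summable fun p : ℕ × ℕ => (c p.1 * d p.2) • y (k - (p.1 + p.2 : ℕ)) := by
    refine Summable.of_norm_bounded ((hc.mul_of_nonneg hd (fun _ => norm_nonneg _)
      fun _ => norm_nonneg _).mul_right M) fun p => ?_
    rw [norm_smul, norm_mul]
    gcongr
    exact hy _
  have hs' := Finset.HasAntidiagonal.sigmaAntidiagonalEquivProd.summable_iff.2 hs
  have h1 : linearFilter c (linearFilter d y) k =
      ∑' p : ℕ × ℕ, (c p.1 * d p.2) • y (k - (p.1 + p.2 : ℕ)) := by
    rw [hs.tsum_prod]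
    refine tsum_congr fun i => ?_
    rw [linearFilter, ← tsum_const_smul'']
    refine tsum_congr fun j => ?_
    rw [smul_smul, sub_sub]
    norm_cast
  rw [h1, linearFilter, ← Finset.HasAntidiagonal.sigmaAntidiagonalEquivProd.tsum_eq]
  refine hs'.tsum_sigma.trans ?_
  refine tsum_congr fun n => ?_
  rw [tsum_fintype, Finset.sum_smul, Finset.univ_eq_attach,
    ← Finset.sum_attach (Finset.HasAntidiagonal.antidiagonal n)]
  refine Finset.sum_congr rfl fun p _ => ?_
  have := Finset.HasAntidiagonal.mem_antidiagonal.1 p.2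
  simp only [Function.comp_apply, Finset.HasAntidiagonal.sigmaAntidiagonalEquivProd_apply, this]

end LinearFilter

/-- Dominated convergence: each fixed s contributes a vanishing term, dominated by a multiple of
r(s). -/
theorem tendsto_sum_mul_sub {r T : ℕ → ℝ} (hr0 : ∀ n, 0 ≤ r n) (hr : Summable r)
    (hT : Tendsto T atTop (𝓝 0)) :
    Tendsto (fun N => ∑ s ∈ Finset.range N, r s * T (N - s)) atTop (𝓝 0) := by
  obtain ⟨A, hA⟩ := hT.norm.bddAbove_range
  have hA : ∀ n, ‖T n‖ ≤ A := fun n => hA ⟨n, rfl⟩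
  have h := tendsto_tsum_of_dominated_convergence
    (f := fun N s => if s < N then r s * T (N - s) else 0) (g := fun _ => 0)
    (bound := fun s => r s * A) (𝓕 := atTop) (hr.mul_right A) (fun s => ?_)
    (Eventually.of_forall fun N s => ?_)
  · rw [tsum_zero] at h
    refine h.congr fun N => ?_
    rw [tsum_eq_sum (s := Finset.range N)]
    · exact Finset.sum_congr rfl fun s hs => if_pos (Finset.mem_range.1 hs)
    · intro s hs
      exact if_neg (by simpa using hs)
  · have h1 := (hT.comp (tendsto_sub_atTop_nat s)).const_mul (r s)
    rw [mul_zero] at h1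
    refine h1.congr' ?_
    filter_upwards [eventually_gt_atTop s] with N hN
    rw [if_pos hN]
    rfl
  · split_ifs
    · rw [norm_mul, Real.norm_of_nonneg (hr0 s)]
      exact mul_le_mul_of_nonneg_left (hA _) (hr0 s)
    · rw [norm_zero]
      exact mul_nonneg (hr0 s) ((norm_nonneg _).trans (hA 0))

/-! ### Causality of the volatility -/

section Causality

variable {Ω : Type*} {mΩ : MeasurableSpace Ω} {P : Measure Ω} {ξ : ℤ → Ω → ℝ}

theorem aestronglyMeasurable_of_tendsto_eLpNorm_one {m : MeasurableSpace Ω} (hm : m ≤ mΩ)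
    {f : Ω → ℝ} {g : ℕ → Ω → ℝ} (hf : MemLp f 1 P) (hg : ∀ n, MemLp (g n) 1 P)
    (hgm : ∀ n, AEStronglyMeasurable[m] (g n) P)
    (h : Tendsto (fun n => eLpNorm (g n - f) 1 P) atTop (𝓝 0)) :
    AEStronglyMeasurable[m] f P := by
  have h1 : Tendsto (fun n => (hg n).toLp (g n)) atTop (𝓝 (hf.toLp f)) :=
    (Lp.tendsto_Lp_iff_tendsto_eLpNorm'' _ hg _ hf).2 h
  have h2 := (isClosed_aestronglyMeasurable (F := ℝ) (p := 1) (μ := P) hm).mem_of_tendsto h1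
    (Eventually.of_forall fun n => (hgm n).congr (hg n).coeFn_toLp.symm)
  exact AEStronglyMeasurable.congr h2 hf.coeFn_toLp

/-- A solution `V` of the moving-average form of the volatility equation is a function of the
past shocks. -/
theorem aestronglyMeasurable_volatility [IsProbabilityMeasure P] {l v c : ℝ} {w T : ℕ → ℝ}
    (hm : ∀ k, Measurable (ξ k)) (hi : iIndepFun ξ P)
    (h2 : ∀ k, MemLp (ξ k) 2 P) (h1 : ∀ k, P[ξ k] = l) (hv : ∀ k, ∫ ω, (ξ k ω - l) ^ 2 ∂P = v)
    (hv0 : 0 ≤ v) (hw0 : ∀ j, 0 ≤ w j) (hw : Summable fun j => w (j + 1))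
    (hw1 : v * ∑' j, w (j + 1) ^ 2 < 1) {V : ℤ → Ω → ℝ} {tail : ℤ → ℕ → Lp ℝ 2 P}
    (htail : ∀ k n, ‖tail k n‖ ≤ T n) (hT : Tendsto T atTop (𝓝 0))
    (hV : ∀ k n, 1 ≤ n → ∀ᵐ ω ∂P, V k ω - ∑ j ∈ Finset.Ico 1 n,
      w j * ((ξ (k - j) ω - l) * V (k - j) ω) = c + tail k n ω) (k : ℤ) :
    AEStronglyMeasurable[sigmaOn ξ (Set.Iio k)] (V k) P := by
  -- For n = 1 the sum is empty, so V(k) is a constant plus an L² tail.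
  have hVL : MemLp (V k) 1 P := by
    have : MemLp (fun ω => c + tail k 1 ω) 2 P := (memLp_const c).add (Lp.memLp _)
    refine (this.mono_exponent one_le_two).ae_eq ?_
    filter_upwards [hV k 1 le_rfl] with ω hω
    simpa using hω.symm
  have hR := memLp_chaos (l := l) (w := w) hm hi h2 k
  have hG : ∀ N : ℕ, MemLp (fun ω => c * ∑ s ∈ Finset.range N, chaos ξ l w k s ω) 1 P := fun N =>
    ((memLp_finsetSum _ fun s _ => hR s).const_mul c).mono_exponent one_le_two
  refine aestronglyMeasurable_of_tendsto_eLpNorm_one (sigmaOn_le hm _) hVL hG (fun N => ?_) ?_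
  · refine Measurable.aestronglyMeasurable ?_
    refine (Finset.measurable_fun_sum _ fun s _ => ?_).const_mul c
    exact (measurable_chaos k s).mono (sigmaOn_mono fun i hi => hi.2) le_rfl
  have hlim := tendsto_sum_mul_sub (fun s => Real.sqrt_nonneg _)
    (summable_sqrt_integral_chaos_sq hm hi h2 h1 hv hv0 hw0 hw hw1 k) hT
  have hlim' := ENNReal.tendsto_ofReal hlim
  rw [ENNReal.ofReal_zero] at hlim'
  refine tendsto_of_tendsto_of_tendsto_of_le_of_le' tendsto_const_nhds hlim'
    (Eventually.of_forall fun _ => zero_le) ?_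
  filter_upwards [eventually_gt_atTop 0] with N hN
  have hae : ∀ᵐ ω ∂P, V k ω = ∑ s ∈ Finset.range N,
      chaos ξ l w k s ω * (c + tail (k - s) (N - s) ω) := by
    have := (ae_ball_iff (Finset.range N).countable_toSet).2
      fun s (hs : s ∈ Finset.range N) =>
        hV (k - s) (N - s) (by have := Finset.mem_range.1 hs; omega)
    filter_upwards [this] with ω hω
    have h := sum_chain_mul_sub w (fun t => ξ (k - t) ω - l) (fun t => V (k - t) ω) hN
    simp only [Nat.cast_zero, sub_zero] at h
    rw [← h]
    refine Finset.sum_congr rfl fun s hs => ?_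
    have hsN := Finset.mem_range.1 hs
    rw [← hω s hs, Finset.sum_Ico_eq_sum_range, Finset.sum_Ico_eq_sum_range]
    congr 2
    rw [show N - (s + 1) = N - s - 1 by omega]
    refine Finset.sum_congr rfl fun t _ => ?_
    rw [show s + 1 + t - s = 1 + t by omega,
      show k - ((s + 1 + t : ℕ) : ℤ) = k - s - ((1 + t : ℕ) : ℤ) by push_cast; ring]
  have hdiff : (fun ω => c * ∑ s ∈ Finset.range N, chaos ξ l w k s ω) - V k =ᵐ[P]
      ∑ s ∈ Finset.range N, -(chaos ξ l w k s • ⇑(tail (k - s) (N - s))) := by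
    filter_upwards [hae] with ω hω
    rw [Pi.sub_apply, hω, Finset.sum_apply, Finset.mul_sum, ← Finset.sum_sub_distrib]
    refine Finset.sum_congr rfl fun s _ => ?_
    simp only [Pi.neg_apply, smul_eq_mul, Pi.mul_apply]
    ring
  rw [eLpNorm_congr_ae hdiff, ENNReal.ofReal_sum_of_nonneg fun s _ =>
    mul_nonneg (Real.sqrt_nonneg _) ((norm_nonneg _).trans (htail k _))]
  refine (eLpNorm_sum_le (fun s _ => ((hR s).1.smul (Lp.aestronglyMeasurable _)).neg) le_rfl).trans
    (Finset.sum_le_sum fun s _ => ?_)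
  rw [eLpNorm_neg, ENNReal.ofReal_mul (Real.sqrt_nonneg _)]
  -- Cauchy–Schwarz, as the tail need not be independent of R(s).
  refine (eLpNorm_smul_le_mul_eLpNorm (p := 2) (q := 2) (Lp.aestronglyMeasurable _) (hR s).1).trans
    (mul_le_mul' ?_ ?_)
  · rw [(hR s).eLpNorm_eq_integral_rpow_norm two_ne_zero ENNReal.ofNat_ne_top]
    simp only [ENNReal.toReal_ofNat, Real.rpow_two, Real.norm_eq_abs, sq_abs, Real.sqrt_eq_rpow,
      one_div]
    rfl
  · rw [← Lp.enorm_def, ← ofReal_norm]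
    exact ENNReal.ofReal_le_ofReal (htail _ _)

end Causality

/-! ### The autocovariance function -/

section Covariance

variable {Ω : Type*} {mΩ : MeasurableSpace Ω} {P : Measure Ω} {ξ : ℤ → Ω → ℝ}

theorem inner_innovation_eq_zero [IsProbabilityMeasure P] {l : ℝ} (hm : ∀ k, Measurable (ξ k))
    (hi : iIndepFun ξ P) (h2 : ∀ k, MemLp (ξ k) 2 P) (h1 : ∀ k, P[ξ k] = l)
    {V : ℤ → Ω → ℝ} (hV : ∀ k, AEStronglyMeasurable[sigmaOn ξ (Set.Iio k)] (V k) P)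
    {e : ℤ → Lp ℝ 2 P} (he : ∀ k, e k =ᵐ[P] fun ω => (ξ k ω - l) * V k ω) {j k : ℤ}
    (hjk : j < k) : inner ℝ (e j) (e k) = 0 := by
  have hξj : Measurable[sigmaOn ξ (Set.Iio k)] fun ω => ξ j ω - l :=
    (measurable_sigmaOn (Set.mem_Iio.2 hjk)).sub_const l
  have hH : AEStronglyMeasurable[sigmaOn ξ (Set.Iio k)]
      (fun ω => (ξ j ω - l) * V j ω * V k ω) P :=
    (hξj.aestronglyMeasurable.mul ((hV j).mono (sigmaOn_mono (Set.Iio_subset_Iio hjk.le)))).mul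
      (hV k)
  -- A strictly measurable version of the past factor is independent of ξ(k). Its integral is
  -- multiplied by E[ξ(k) - l] = 0, so its value is irrelevant.
  have hind := indepFun_shock (l := l) (i := k) hm hi (Set.self_notMem_Iio)
    hH.stronglyMeasurable_mk.measurable
  have h := hind.integral_mul_eq_mul_integral ((hm _).sub_const l).aestronglyMeasurable
    (hH.stronglyMeasurable_mk.mono (sigmaOn_le hm _)).aestronglyMeasurable
  rw [integral_sub ((h2 _).integrable one_le_two) (integrable_const _), h1] at h
  simp only [integral_const, probReal_univ, one_smul, sub_self, zero_mul] at h
  rw [L2.inner_def, ← h]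
  refine integral_congr_ae ?_
  filter_upwards [he j, he k, hH.ae_eq_mk] with ω h3 h4 h5
  rw [Pi.mul_apply, ← h5, h3, h4]
  simp only [RCLike.inner_apply, conj_trivial]
  ring

theorem inner_linearFilter {E : Type*} [NormedAddCommGroup E] [InnerProductSpace ℝ E]
    [CompleteSpace E] {z : ℕ → ℝ} {e : ℤ → E} {M : ℝ} (hz : Summable fun j => ‖z j‖)
    (hM : ∀ k, ‖e k‖ ≤ M) (he : ∀ j k, j ≠ k → inner ℝ (e j) (e k) = 0) (n : ℕ) :
    HasSum (fun i : ℕ => z i * (z (n + i) * ‖e (-i)‖ ^ 2))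
      (inner ℝ (linearFilter z e 0) (linearFilter z e n)) := by
  have hs : ∀ k, HasSum (fun j : ℕ => z j • e (k - j)) (linearFilter z e k) := fun k =>
    (summable_norm_filter hz hM k).of_norm.hasSum
  have h1 : ∀ i : ℕ, inner ℝ (e (-i)) (linearFilter z e n) = z (n + i) * ‖e (-i)‖ ^ 2 := fun i => by
    have h := (hs n).mapL (innerSL ℝ (e (-i)))
    simp only [innerSL_apply_apply, inner_smul_right] at h
    refine h.unique ?_
    rw [← real_inner_self_eq_norm_sq]
    convert hasSum_single (n + i) fun j hj => ?_ using 3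
    · push_cast
      congr 1
      ring
    · rw [he _ _ (by omega), mul_zero]
  have h := (hs 0).mapL (innerSL ℝ (linearFilter z e n))
  simp only [innerSL_apply_apply, inner_smul_right, zero_sub] at h
  rw [real_inner_comm]
  have hf : (fun i : ℕ => z i * (z (n + i) * ‖e (-i)‖ ^ 2)) =
      fun i : ℕ => z i * inner ℝ (linearFilter z e n) (e (-i)) :=
    funext fun i => by rw [← h1, real_inner_comm]
  rw [hf]
  exact h

theorem memLp_shock {a : ℝ} {b : ℕ → ℝ} {X : ℤ → Ω → ℝ} (hX : IsSolution P a b ξ X)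
    (hξ : MemLp (ξ 0) 2 P) (k : ℤ) : MemLp (ξ k) 2 P :=
  (hX.identDistrib k).memLp_iff.2 hξ

theorem integral_shock {a : ℝ} {b : ℕ → ℝ} {X : ℤ → Ω → ℝ} (hX : IsSolution P a b ξ X) (k : ℤ) :
    P[ξ k] = P[ξ 0] :=
  (hX.identDistrib k).integral_eq

theorem integral_shock_sub_sq {a : ℝ} {b : ℕ → ℝ} {X : ℤ → Ω → ℝ} (hX : IsSolution P a b ξ X)
    (k : ℤ) : ∫ ω, (ξ k ω - P[ξ 0]) ^ 2 ∂P = Var[ξ 0; P] := by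
  rw [← (hX.identDistrib k).variance_eq, variance_eq_integral (hX.measurable_shock k).aemeasurable,
    integral_shock hX k]

theorem integral_sub_sq [IsProbabilityMeasure P] {X : ℤ → Ω → ℝ} (hX : IsWeaklyStationary P X)
    (c : ℝ) (k : ℤ) : ∫ ω, (X k ω - c) ^ 2 ∂P = autocov P X 0 + (P[X 0] - c) ^ 2 := by
  have hv : Var[X k; P] = autocov P X 0 := by
    rw [← hX.cov_eq k 0, add_zero, covariance_self (hX.memLp k).1.aemeasurable]
  have hL : MemLp (fun ω => X k ω - c) 2 P := (hX.memLp k).sub (memLp_const c)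
  have h := variance_eq_sub hL
  rw [variance_sub_const (hX.memLp k).1, hv, integral_sub ((hX.memLp k).integrable one_le_two)
    (integrable_const _), hX.mean_eq] at h
  simp only [integral_const, probReal_univ, one_smul] at h
  simp only [Pi.pow_apply] at h
  linarith

/-- The volatility `a + ∑_{j ≥ 1} b(j) X(k - j)`. -/
noncomputable def volatility (a : ℝ) (b : ℕ → ℝ) (X : ℤ → Ω → ℝ) (k : ℤ) (ω : Ω) : ℝ :=
  a + ∑' j : ℕ, b (j + 1) * X (k - (j + 1)) ω

theorem coeff_symbol_succ (l : ℝ) (b : ℕ → ℝ) (j : ℕ) :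
    PowerSeries.coeff (j + 1) (symbol l b) = -(l * b (j + 1)) := by
  simp [symbol, PowerSeries.coeff_one]

theorem coeff_symbol_zero (l : ℝ) (b : ℕ → ℝ) : PowerSeries.coeff 0 (symbol l b) = 1 := by
  simp [symbol]

/-- The moving-average representation of a weakly stationary solution. -/
theorem exists_movingAverage [IsProbabilityMeasure P] {a : ℝ} {b : ℕ → ℝ} {X : ℤ → Ω → ℝ}
    (hX : IsSolution P a b ξ X) (hstat : IsWeaklyStationary P X) (hl : 0 < P[ξ 0])
    (hs : Summable fun j : ℕ => b (j + 1)) (h1 : P[ξ 0] * ∑' j : ℕ, b (j + 1) < 1) :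
    ∃ (c M : ℝ) (x e : ℤ → Lp ℝ 2 P), (∀ k, ‖e k‖ ≤ M) ∧
      (∀ k, x k =ᵐ[P] fun ω => X k ω - P[ξ 0] * c) ∧
      (∀ k, x k = linearFilter (resolvent (P[ξ 0]) b) e k) ∧
      ∀ k, e k =ᵐ[P] fun ω => (ξ k ω - P[ξ 0]) * volatility a b X k ω := by
  set l := P[ξ 0]
  set B := ∑' j : ℕ, b (j + 1)
  -- The solution of the averaged equation c = a + lBc.
  set c := a / (1 - l * B) with hc
  have hc' : c * (1 - l * B) = a := div_mul_cancel₀ _ (by linarith)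
  have hL : ∀ k, MemLp (fun ω => X k ω - l * c) 2 P := fun k =>
    (hstat.memLp k).sub (memLp_const _)
  set x : ℤ → Lp ℝ 2 P := fun k => (hL k).toLp _ with hx
  have hxae : ∀ k, x k =ᵐ[P] fun ω => X k ω - l * c := fun k => (hL k).coeFn_toLp
  have hxn : ∀ k, ‖x k‖ ≤ √(autocov P X 0 + (P[X 0] - l * c) ^ 2) := fun k => by
    refine Real.le_sqrt_of_sq_le (le_of_eq ?_)
    rw [← integral_sub_sq hstat _ k, ← real_inner_self_eq_norm_sq, L2.inner_def]
    refine integral_congr_ae ?_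
    filter_upwards [hxae k] with ω hω
    simp only [RCLike.inner_apply, conj_trivial, hω]
    ring
  set p : ℕ → ℝ := fun j => PowerSeries.coeff j (symbol l b) with hp
  have hp0 : p 0 = 1 := coeff_symbol_zero l b
  have hpS : ∀ j, p (j + 1) = -(l * b (j + 1)) := coeff_symbol_succ l b
  have hpn : Summable fun j => ‖p j‖ := by
    rw [← summable_nat_add_iff 1]
    simp only [hpS, norm_neg, norm_mul]
    exact hs.norm.mul_left _
  have hzn : Summable fun j => ‖resolvent l b j‖ :=
    (summable_resolvent hl.le hX.b_nonneg hs h1).norm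
  -- The innovations are ψ applied to x; since z ∗ p is the unit sequence, filtering by z recovers
  -- x.
  refine ⟨c, _, x, linearFilter p x, fun k => norm_linearFilter_le hpn hxn k, hxae,
    fun k => ?_, fun k => ?_⟩
  · rw [linearFilter_linearFilter hzn hpn hxn, linearFilter, tsum_eq_single 0]
    · simp [hp0, resolvent_zero]
    · intro n hn
      have h := congrArg (PowerSeries.coeff n) (symbol_mul_inv l b)
      rw [mul_comm, PowerSeries.coeff_mul, PowerSeries.coeff_one, if_neg hn] at h
      rw [← zero_smul ℝ (x (k - n)), ← h]
      rfl
  · have hsum : ∑' j : ℕ, ‖p j • x (k - j)‖ₑ ≠ ∞ :=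
      tsum_enorm_ne_top_iff_summable_norm.2 (summable_norm_filter hpn hxn k)
    have hsm : ∀ᵐ ω ∂P, ∀ j : ℕ, (p j • x (k - j)) ω = p j * (X (k - j) ω - l * c) := by
      refine ae_all_iff.2 fun j => ?_
      filter_upwards [Lp.coeFn_smul (p j) (x (k - j)), hxae (k - j)] with ω h2 h3
      rw [h2, Pi.smul_apply, h3, smul_eq_mul]
    filter_upwards [Lp.hasSum_coeFn_tsum hsum, hsm, hX.summable k, hX.eq k] with ω h2 h3 h4 h5
    simp only [h3] at h2
    refine h2.unique ?_
    refine (hasSum_nat_add_iff' 1).1 ?_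
    simp only [Finset.sum_range_one, hp0, hpS, Nat.cast_zero, sub_zero, one_mul]
    have hval : (ξ k ω - l) * volatility a b X k ω - (X k ω - l * c) =
        -l * (∑' j : ℕ, b (j + 1) * X (k - (j + 1)) ω - B * (l * c)) := by
      rw [h5, volatility]
      linear_combination l * hc'
    have hterm : (fun j : ℕ => -(l * b (j + 1)) * (X (k - (j + 1 : ℕ)) ω - l * c)) =
        fun j : ℕ => -l * (b (j + 1) * X (k - (j + 1)) ω - b (j + 1) * (l * c)) :=
      funext fun j => by push_cast; ring
    rw [hval, hterm]
    exact (h4.hasSum.sub (hs.hasSum.mul_right (l * c))).mul_left (-l)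

theorem inner_innovation_eq_zero_of_ne [IsProbabilityMeasure P] {a c M : ℝ} {b : ℕ → ℝ}
    {X : ℤ → Ω → ℝ} (hX : IsSolution P a b ξ X) (hξ : MemLp (ξ 0) 2 P) (hl : 0 < P[ξ 0])
    (hs : Summable fun j : ℕ => b (j + 1)) (h1 : P[ξ 0] * ∑' j : ℕ, b (j + 1) < 1)
    (hΩ : stationarityConst P b ξ < 1) {x e : ℤ → Lp ℝ 2 P} (hM : ∀ k, ‖e k‖ ≤ M)
    (hx : ∀ k, x k =ᵐ[P] fun ω => X k ω - P[ξ 0] * c)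
    (hxe : ∀ k, x k = linearFilter (resolvent (P[ξ 0]) b) e k)
    (he : ∀ k, e k =ᵐ[P] fun ω => (ξ k ω - P[ξ 0]) * volatility a b X k ω)
    (j k : ℤ) (hjk : j ≠ k) : inner ℝ (e j) (e k) = 0 := by
  set l := P[ξ 0]
  set z := resolvent l b
  have hz0 : ∀ j, 0 ≤ z j := resolvent_nonneg hl.le hX.b_nonneg
  have hzs : Summable z := summable_resolvent hl.le hX.b_nonneg hs h1
  have hT : Tendsto (fun n => l⁻¹ * ((∑' j, z (j + n)) * M)) atTop (𝓝 0) := by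
    simpa using ((tendsto_sum_nat_add z).mul_const M).const_mul l⁻¹
  have hcaus : ∀ k, AEStronglyMeasurable[sigmaOn ξ (Set.Iio k)] (volatility a b X k) P := by
    refine aestronglyMeasurable_volatility (c := c) (w := fun j => z j / l)
      (tail := fun k n => l⁻¹ • (x k - ∑ j ∈ Finset.range n, z j • e (k - j)))
      hX.measurable_shock hX.indep (memLp_shock hX hξ) (integral_shock hX)
      (integral_shock_sub_sq hX) (variance_nonneg _ _) (fun j => div_nonneg (hz0 j) hl.le)
      (((summable_nat_add_iff 1).2 hzs).div_const l) ?_ (fun k n => ?_) hT fun k n hn => ?_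
    · have h2 : Var[ξ 0; P] * ∑' j, (z (j + 1) / l) ^ 2 = stationarityConst P b ξ ^ 2 := by
        rw [stationarityConst, mul_pow, div_pow, Real.sq_sqrt (variance_nonneg _ _),
          Real.sq_sqrt (tsum_nonneg fun _ => sq_nonneg _)]
        simp only [div_pow, tsum_div_const]
        ring
      rw [h2]
      have h3 : 0 ≤ stationarityConst P b ξ :=
        mul_nonneg (div_nonneg (Real.sqrt_nonneg _) hl.le) (Real.sqrt_nonneg _)
      nlinarith
    · have hsm := (summable_norm_filter (hzs.norm) hM k).of_norm
      rw [hxe, linearFilter, ← hsm.sum_add_tsum_nat_add n, add_sub_cancel_left, norm_smul,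
        Real.norm_of_nonneg (inv_nonneg.2 hl.le)]
      refine mul_le_mul_of_nonneg_left ?_ (inv_nonneg.2 hl.le)
      refine tsum_of_norm_bounded (((summable_nat_add_iff n).2 hzs).hasSum.mul_right M) fun j => ?_
      rw [norm_smul, Real.norm_of_nonneg (hz0 _)]
      exact mul_le_mul_of_nonneg_left (hM _) (hz0 _)
    · have h2 : ∀ᵐ ω ∂P, ∀ j : ℕ, (z j • e (k - j)) ω =
          z j * ((ξ (k - j) ω - l) * volatility a b X (k - j) ω) := by
        refine ae_all_iff.2 fun j => ?_
        filter_upwards [Lp.coeFn_smul (z j) (e (k - j)), he (k - j)] with ω h2 h3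
        rw [h2, Pi.smul_apply, h3, smul_eq_mul]
      filter_upwards [h2, Lp.coeFn_smul l⁻¹ (x k - ∑ j ∈ Finset.range n, z j • e (k - j)),
        Lp.coeFn_sub (x k) (∑ j ∈ Finset.range n, z j • e (k - j)),
        Lp.coeFn_fun_finsetSum (Finset.range n) fun j : ℕ => z j • e (k - j), hx k, hX.eq k]
        with ω h3 h4 h5 h6 h7 h8
      rw [h4, Pi.smul_apply, h5, Pi.sub_apply, h6, h7, h8, Finset.sum_congr rfl fun j _ => h3 j,
        Finset.range_eq_Ico, Finset.sum_eq_sum_Ico_succ_bot (a := 0) (by omega)]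
      simp only [Nat.cast_zero, sub_zero, zero_add, smul_eq_mul]
      rw [show z 0 = 1 from resolvent_zero l b]
      change volatility a b X k ω - _ = c + l⁻¹ * (volatility a b X k ω * ξ k ω - l * c - _)
      simp only [div_mul_eq_mul_div, ← Finset.sum_div]
      field_simp
      ring
  rcases lt_or_gt_of_ne hjk with h | h
  · exact inner_innovation_eq_zero hX.measurable_shock hX.indep (memLp_shock hX hξ)
      (integral_shock hX) hcaus he h
  · rw [real_inner_comm]
    exact inner_innovation_eq_zero hX.measurable_shock hX.indep (memLp_shock hX hξ)
      (integral_shock hX) hcaus he h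

/-- Centring at any c adds the square (E X - c)² to the covariance, so c need not be identified with
the mean. -/
theorem autocov_le_inner [IsProbabilityMeasure P] {X : ℤ → Ω → ℝ} (hX : IsWeaklyStationary P X)
    {c : ℝ} {x : ℤ → Lp ℝ 2 P} (hx : ∀ k, x k =ᵐ[P] fun ω => X k ω - c) (k : ℤ) :
    autocov P X k ≤ inner ℝ (x 0) (x k) := by
  have hL : ∀ k, MemLp (fun ω => X k ω - c) 2 P := fun k => (hX.memLp k).sub (memLp_const c)
  have hi : ∀ k, Integrable (X k) P := fun k => (hX.memLp k).integrable one_le_two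
  have h := covariance_eq_sub (hL 0) (hL k)
  rw [covariance_sub_const_left (hi 0), covariance_sub_const_right (hi k),
    integral_sub (hi 0) (integrable_const _), integral_sub (hi k) (integrable_const _),
    hX.mean_eq k] at h
  have h2 : inner ℝ (x 0) (x k) = P[(fun ω => X 0 ω - c) * fun ω => X k ω - c] := by
    rw [L2.inner_def]
    refine integral_congr_ae ?_
    filter_upwards [hx 0, hx k] with ω h3 h4
    simp only [RCLike.inner_apply, conj_trivial, h3, h4, Pi.mul_apply]
    ring
  rw [autocov, h, h2]
  exact sub_le_self _ (mul_self_nonneg _)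

end Covariance
end ARCH

theorem theorem5p1 {Ω : Type*} [MeasurableSpace Ω] (P : Measure Ω) [IsProbabilityMeasure P]
    (a : ℝ) (b : ℕ → ℝ) (ξ X : ℤ → Ω → ℝ)
    (hX : ARCH.IsSolution P a b ξ X) (hstat : ARCH.IsWeaklyStationary P X)
    (hξ : MemLp (ξ 0) 2 P) (hmean : 0 < P[ξ 0]) (hvar : 0 < Var[ξ 0; P])
    (ha : 0 < a) (hb : ∃ j, 1 ≤ j ∧ b j ≠ 0)
    (r : ℝ) (hr0 : 0 < r) (hr1 : r ≤ 1)
    (hsum : Summable fun j : ℕ => b (j + 1) * (r ^ (j + 1))⁻¹)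
    (hlt : P[ξ 0] * ∑' j : ℕ, b (j + 1) * (r ^ (j + 1))⁻¹ < 1)
    (hΩ : ARCH.stationarityConst P b ξ < 1)
    (γ : ℕ → ℝ) (hγ : ARCH.MemWDown r γ) (hbγ : ∀ n, 1 ≤ n → b n ≤ γ n) :
    ∃ C₂ : ℝ, 0 < C₂ ∧ ∀ n : ℕ, ARCH.autocov P X n ≤ C₂ * γ n := by
  have hb0 : ∀ j : ℕ, 0 ≤ b (j + 1) := fun j => hX.b_nonneg _ (by omega)
  -- As r ≤ 1, the weights r^{-j} are at least 1, so the unweighted conditions follow.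
  have hle : ∀ j : ℕ, b (j + 1) ≤ b (j + 1) * (r ^ (j + 1))⁻¹ := fun j =>
    le_mul_of_one_le_right (hb0 j) ((one_le_inv₀ (by positivity)).2 (pow_le_one₀ hr0.le hr1))
  have hs : Summable fun j : ℕ => b (j + 1) := hsum.of_nonneg_of_le hb0 hle
  have h1 : P[ξ 0] * ∑' j : ℕ, b (j + 1) < 1 :=
    (mul_le_mul_of_nonneg_left (hs.tsum_le_tsum hle hsum) hmean.le).trans_lt hlt
  obtain ⟨c, M, x, e, hM, hx, hxe, he⟩ := ARCH.exists_movingAverage hX hstat hmean hs h1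
  have horth := ARCH.inner_innovation_eq_zero_of_ne hX hξ hmean hs h1 hΩ hM hx hxe he
  obtain ⟨C, C0, hC⟩ := ARCH.exists_resolvent_le hmean.le hX.b_nonneg hr0 hsum hlt hγ.toMemW hbγ
  obtain ⟨D, D0, hD⟩ := hγ.exists_add_le
  have hz0 := ARCH.resolvent_nonneg hmean.le hX.b_nonneg
  have hzs := ARCH.summable_resolvent hmean.le hX.b_nonneg hs h1
  set z := ARCH.resolvent (P[ξ 0]) b
  have hS : 0 ≤ ∑' i, z i := tsum_nonneg hz0
  refine ⟨(∑' i, z i) * (C * D * M ^ 2) + 1, by positivity, fun n => ?_⟩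
  have hp := hγ.pos n
  have h := ARCH.inner_linearFilter hzs.norm hM horth n
  rw [← hxe, ← hxe] at h
  have h2 := hasSum_le (fun i => ?_) h (hzs.hasSum.mul_right (C * D * M ^ 2 * γ n))
  · calc ARCH.autocov P X n ≤ _ := ARCH.autocov_le_inner hstat hx n
      _ ≤ _ := h2
      _ ≤ _ := by linarith
  · refine mul_le_mul_of_nonneg_left ?_ (hz0 i)
    calc z (n + i) * ‖e (-i)‖ ^ 2 ≤ (C * (D * γ n)) * M ^ 2 := by
          gcongr
          · exact (hC _).trans (mul_le_mul_of_nonneg_left (hD n i) C0.le)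
          · exact hM _
      _ = C * D * M ^ 2 * γ n := by ring
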